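/- All groups are finite and $p$ is a prime. A Camina $p$-group is a $p$-group $G$ such that for every $g\in G\setminus G'$ the conjugacy class of $g$ is the coset $gG'$. Let $G$ be a Camina $p$-group of nilpotence class $3$, and put $G_3=[G',G]$. For $a\in G\setminus G'$ let $A(a)=\{x\in G : [a,x]\in G_3\}$, i.e. $A(a)/G_3=C_{G/G_3}(aG_3)$, and set $\mathcal A(G)=\{A(a) : a\in G\setminus G'\}$ and $\mathcal A^*(G)=\{A\in\mathcal A(G) : A/G_3 \text{ is abelian}\}$. For $N\le G_3$ with $|G_3:N|=p$ let $C(N)$ be the subgroup containing $N$ with $C(N)/N=C_{G/N}(G'/N)$, and set $\mathcal C(G)=\{C(N) : N\le G_3,\ |G_3:N|=p\}$. If $A\in\mathcal A^*(G)\setminus\mathcal C(G)$, then $A$ is semi-extraspecial, i.e. $A$ is a nontrivial $p$-group such that for every subgroup $N$ of index $p$ in $Z(A)$ the quotient $E=A/N$ is extraspecial, meaning that $E$ is a $p$-group, $Z(E)=E'=\Phi(E)$ (the Frattini subgroup) and $|Z(E)|=p$. -/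

import Mathlib

open scoped Pointwise commutatorElement

namespace CaminaGroup

/-- `G` is a Camina group: for every `g ∈ G \ G'` the conjugacy class of `g` is the coset `gG'`. -/
def IsCamina (G : Type*) [Group G] : Prop :=
  ∀ g : G, g ∉ commutator G → conjugatesOf g = g • (commutator G : Set G)

/-- `G₃ = [G', G]`. -/
def third (G : Type*) [Group G] : Subgroup G :=
  ⁅commutator G, (⊤ : Subgroup G)⁆

instance third_normal (G : Type*) [Group G] : (third G).Normal := by
  unfold third
  infer_instance

/-- `A(a)`, the subgroup with `A(a)/G₃ = C_{G/G₃}(aG₃)`. -/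
def centA {G : Type*} [Group G] (a : G) : Subgroup G :=
  (Subgroup.centralizer {(QuotientGroup.mk' (third G)) a}).comap (QuotientGroup.mk' (third G))

/-- `A(a) = {x ∈ G | [a, x] ∈ G₃}`. -/
theorem mem_centA_iff {G : Type*} [Group G] (a x : G) : x ∈ centA a ↔ ⁅a, x⁆ ∈ third G := by
  have h : ⁅a, x⁆ ∈ third G ↔ (QuotientGroup.mk' (third G)) ⁅a, x⁆ = 1 :=
    (QuotientGroup.eq_one_iff _).symm
  rw [h, map_commutatorElement, commutatorElement_eq_one_iff_mul_comm]
  unfold centA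
  rw [Subgroup.mem_comap, Subgroup.mem_centralizer_singleton_iff]
  exact eq_comm

/-- `𝒜(G) = {A(a) | a ∈ G \ G'}`. -/
def setA (G : Type*) [Group G] : Set (Subgroup G) :=
  {A | ∃ a : G, a ∉ commutator G ∧ A = centA a}

/-- `𝒜*(G)`: the members `A` of `𝒜(G)` such that `A/G₃` is abelian
(`A/G₃` is the image of `A` in `G/G₃`; every `A ∈ 𝒜(G)` contains `G₃`). -/
def setAStar (G : Type*) [Group G] : Set (Subgroup G) :=
  {A | A ∈ setA G ∧ IsMulCommutative (A.map (QuotientGroup.mk' (third G)))}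

/-- `C(N)`, the subgroup with `C(N)/N = C_{G/N}(G'/N)`. -/
def centC {G : Type*} [Group G] (N : Subgroup G) [N.Normal] : Subgroup G :=
  (Subgroup.centralizer ((commutator G).map (QuotientGroup.mk' N) : Set (G ⧸ N))).comap
    (QuotientGroup.mk' N)

/-- `𝒞(G) = {C(N) | N ≤ G₃, |G₃ : N| = p}`. When `G` has class at most three, `G₃` is central,
so each such `N` is automatically normal. -/
def setC (p : ℕ) (G : Type*) [Group G] : Set (Subgroup G) :=
  {C | ∃ (N : Subgroup G) (_ : N.Normal), N ≤ third G ∧ N.relIndex (third G) = p ∧ C = centC N}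

/-- An extraspecial `p`-group: `Z(E) = E' = Φ(E)` has order `p`. -/
structure IsExtraspecial (p : ℕ) (E : Type*) [Group E] : Prop where
  isPGroup : IsPGroup p E
  card_center : Nat.card (Subgroup.center E) = p
  commutator_eq : commutator E = Subgroup.center E
  frattini_eq : frattini E = Subgroup.center E

/-- A semi-extraspecial `p`-group: a nontrivial `p`-group `H` such that `H/N` is extraspecial for
every `N ≤ Z(H)` with `|Z(H) : N| = p` (such an `N` is automatically normal in `H`). -/
structure IsSemiExtraspecial (p : ℕ) (H : Type*) [Group H] : Prop where
  isPGroup : IsPGroup p H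
  nontrivial : Nontrivial H
  quotient : ∀ (N : Subgroup H) [N.Normal], N ≤ Subgroup.center H →
    N.relIndex (Subgroup.center H) = p → IsExtraspecial p (H ⧸ N)

end CaminaGroup

namespace CaminaGroup

/-! ### Alternating matrices: determinants and zeros over finite fields -/

open Matrix Module

/-! Put V = G/G' and W = G'/G₃, which turn out to be 𝔽_p-spaces. Commutators give an alternating
form β : V × V → W, and the Camina condition makes β(a, ·) surjective for every a ≠ 0. For N of
index p in G₃, commutators modulo N give a nonzero pairing τ : W × V → 𝔽_p. Let C = C(N)/G' be its
right kernel; the three subgroups lemma gives τ(β(C, C), ·) = 0.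

The heart is a dimension count. The determinant of the generic form l ∘ β is the square of a
polynomial r in the coefficients of l. If 2 dim W > dim V, then deg r < dim W, and a
Chevalley–Warning argument yields l ≠ 0 with l ∘ β degenerate, against surjectivity. So 2 dim W ≤
dim V (`two_mul_finrank_le`). Also C is isotropic for some nondegenerate l ∘ β, so 2 dim C ≤ dim V,
while dim V - dim C is the rank of τ, at most dim W. All bounds are therefore equalities and τ has
no left kernel (`finrank_eq_of_isotropic`).

Let U = A/G' = ker β(a). It has the dimension of C, and β vanishes on U. If U ≠ C this forces V = U
⊕ C, so τ on W × U has no left kernel (`nondegenerate_of_ker_ne`). Hence an x in A with [x, A] ≤ N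
lies first in A ∩ C(N) = G', then in G₃. Thus Z(A) = G₃ and A/N has centre G₃/N of order p; this is
also its derived subgroup, since A/G₃ is abelian and A/N is not. -/

theorem isSquare_det_of_alternating {K : Type*} [Field K] (k : ℕ) :
    ∀ {ι : Type*} [Fintype ι] [DecidableEq ι] (_ : Fintype.card ι = k) (M : Matrix ι ι K),
      Mᵀ = -M → (∀ i, M i i = 0) → IsSquare M.det := by
  induction k using Nat.strong_induction_on with
  | _ k ih =>
    intro ι _ _ hk M hM hd
    by_cases h0 : M = 0
    · subst h0
      cases isEmpty_or_nonempty ι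
      · simp
      · simp [Matrix.det_zero]
    obtain ⟨i, j, hij⟩ : ∃ i j, M i j ≠ 0 := by
      by_contra! h
      exact h0 (Matrix.ext h)
    have hne : i ≠ j := by
      rintro rfl
      exact hij (hd i)
    have hskew : ∀ x y, M x y = -M y x := fun x y => by
      have := congrFun (congrFun hM y) x
      simpa using this
    let κ := {x : ι // ¬ (x = i ∨ x = j)}
    let f : Fin 2 ≃ {x : ι // x = i ∨ x = j} :=
      Equiv.ofBijective ![⟨i, Or.inl rfl⟩, ⟨j, Or.inr rfl⟩] (by
        constructor
        · intro a b
          fin_cases a <;> fin_cases b <;> simp [hne, hne.symm]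
        · rintro ⟨x, rfl | rfl⟩
          · exact ⟨0, rfl⟩
          · exact ⟨1, rfl⟩)
    let e : Fin 2 ⊕ κ ≃ ι := (Equiv.sumCongr f (Equiv.refl κ)).trans
      (Equiv.sumCompl fun x => x = i ∨ x = j)
    have hcard : Fintype.card κ < k := by
      have := Fintype.card_congr e
      simp only [Fintype.card_sum, Fintype.card_fin] at this
      omega
    set a := M i j with ha
    let B : Matrix (Fin 2) κ K := fun x y => M (e (Sum.inl x)) (e (Sum.inr y))
    let D : Matrix κ κ K := fun x y => M (e (Sum.inr x)) (e (Sum.inr y))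
    let P : Matrix (Fin 2) (Fin 2) K := !![0, a; -a, 0]
    have hP : M.submatrix e e = fromBlocks P B (-Bᵀ) D := by
      ext x y
      rcases x with x | x <;> rcases y with y | y
      · fin_cases x <;> fin_cases y
        · exact hd i
        · rfl
        · exact hskew j i
        · exact hd j
      · rfl
      · exact hskew _ _
      · rfl
    have hPP : P * !![0, -a⁻¹; a⁻¹, 0] = 1 := by
      ext x y
      fin_cases x <;> fin_cases y <;> simp [P, Matrix.mul_apply, hij]
    have hPP' : !![0, -a⁻¹; a⁻¹, 0] * P = 1 := mul_eq_one_comm.mp hPP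
    -- Splitting off the pivot block P, of determinant a², leaves a Schur complement that is again
    -- alternating and smaller.
    let : Invertible P := ⟨_, hPP', hPP⟩
    have hinv : ⅟P = !![0, -a⁻¹; a⁻¹, 0] := rfl
    have hdet : M.det = P.det * (D - -Bᵀ * ⅟P * B).det := by
      rw [← det_submatrix_equiv_self e M, hP, det_fromBlocks₁₁]
    rw [hdet]
    refine IsSquare.mul ⟨a, ?_⟩ (ih _ hcard rfl _ ?_ ?_)
    · simp [P, det_fin_two]
    · have h1 : (⅟P)ᵀ = -⅟P := by
        rw [hinv]
        ext x y
        fin_cases x <;> fin_cases y <;> simp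
      have h2 : Dᵀ = -D := by
        ext x y
        exact hskew _ _
      simp only [Matrix.neg_mul, sub_neg_eq_add, transpose_add, transpose_mul, h1, h2,
        transpose_transpose, neg_add, Matrix.mul_neg, Matrix.mul_assoc]
    · intro x
      have h3 : D x x = 0 := hd _
      simp only [Matrix.neg_mul, sub_neg_eq_add, Matrix.add_apply, h3, hinv, Matrix.mul_apply,
        Fin.sum_univ_two, transpose_apply]
      simp
      ring

/-- A square root in the fraction field is integral over R, hence lies in R. -/
theorem isSquare_det_of_alternating_of_isIntegrallyClosed {R : Type*} [CommRing R] [IsDomain R]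
    [IsIntegrallyClosed R] {ι : Type*} [Fintype ι] [DecidableEq ι] (M : Matrix ι ι R)
    (hM : Mᵀ = -M) (hd : ∀ i, M i i = 0) : IsSquare M.det := by
  let f := algebraMap R (FractionRing R)
  have h : IsSquare (f.mapMatrix M).det := by
    refine isSquare_det_of_alternating _ rfl _ ?_ ?_
    · ext i j
      have := congrFun (congrFun hM i) j
      simp only [transpose_apply] at this
      simp [this]
    · intro i
      simp [hd]
  rw [← RingHom.map_det] at h
  obtain ⟨r, hr⟩ := h
  obtain ⟨s, rfl⟩ := IsIntegrallyClosed.exists_algebraMap_eq_of_isIntegral_pow (R := R) (x := r)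
    two_pos (by rw [pow_two, ← hr]; exact isIntegral_algebraMap)
  refine ⟨s, IsFractionRing.injective R (FractionRing R) ?_⟩
  rw [map_mul]
  exact hr

theorem totalDegree_det_le {σ R ι : Type*} [CommRing R] [Fintype ι] [DecidableEq ι]
    (M : Matrix ι ι (MvPolynomial σ R)) (hM : ∀ i j, (M i j).totalDegree ≤ 1) :
    M.det.totalDegree ≤ Fintype.card ι := by
  rw [Matrix.det_apply]
  refine MvPolynomial.totalDegree_finsetSum_le fun π _ => ?_
  have h : (∏ i, M (π i) i).totalDegree ≤ Fintype.card ι := by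
    refine (MvPolynomial.totalDegree_finsetProd _ _).trans ?_
    refine (Finset.sum_le_sum fun i _ => hM (π i) i).trans ?_
    simp
  rcases Int.units_eq_one_or (Equiv.Perm.sign π) with h' | h' <;> rw [h']
  · simpa using h
  · simpa [MvPolynomial.totalDegree_neg] using h

/-- A linear system of alternating matrices all of whose nonzero members are invertible has at
most half as many parameters as rows. -/
theorem two_mul_card_le_of_det_ne_zero {K : Type*} [Field K] [Fintype K] {ι σ : Type*}
    [Fintype ι] [DecidableEq ι] [Nonempty ι] [Fintype σ] (M : σ → Matrix ι ι K)
    (hM : ∀ s, (M s)ᵀ = -M s) (hd : ∀ s i, M s i i = 0)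
    (hdet : ∀ l : σ → K, l ≠ 0 → (∑ s, l s • M s).det ≠ 0) :
    2 * Fintype.card σ ≤ Fintype.card ι := by
  classical
  by_contra! hlt
  let X : Matrix ι ι (MvPolynomial σ K) :=
    fun i j => ∑ s, MvPolynomial.X s * MvPolynomial.C (M s i j)
  have hskew : ∀ s i j, M s i j = -M s j i := fun s i j => by
    simpa using congrFun (congrFun (hM s) j) i
  obtain ⟨r, hr⟩ := isSquare_det_of_alternating_of_isIntegrallyClosed X
    (by
      ext1 i j
      change X j i = -X i j
      simp only [X, ← Finset.sum_neg_distrib]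
      exact Finset.sum_congr rfl fun s _ => by rw [hskew s j i, map_neg, mul_neg])
    (fun i => Finset.sum_eq_zero fun s _ => by rw [hd, map_zero, mul_zero])
  have heval : ∀ l : σ → K, MvPolynomial.eval l r * MvPolynomial.eval l r
      = (∑ s, l s • M s).det := by
    intro l
    rw [← map_mul, ← hr, RingHom.map_det]
    congr 1
    ext i j
    change MvPolynomial.eval l (X i j) = _
    simp [X, Matrix.sum_apply]
  have hX : X.det.totalDegree ≤ Fintype.card ι := by
    refine totalDegree_det_le _ fun i j => ?_
    refine MvPolynomial.totalDegree_finsetSum_le fun s _ => ?_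
    refine (MvPolynomial.totalDegree_mul _ _).trans ?_
    simp
  have hr2 : 2 * r.totalDegree ≤ Fintype.card ι := by
    by_cases h0 : r = 0
    · simp [h0]
    · rw [hr, MvPolynomial.totalDegree_mul_of_isDomain h0 h0] at hX
      omega
  have hq : 1 < Fintype.card K := Fintype.one_lt_card
  -- With q = |K|, 2 deg r ≤ |ι| < 2|σ| puts the degree of r^(q-1) below (q-1)|σ|, so its values sum
  -- to 0. But it is 0 at the origin and 1 elsewhere, so the sum is q^|σ| - 1 = -1 in K.
  have hsum := MvPolynomial.sum_eval_eq_zero (r ^ (Fintype.card K - 1)) (by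
    refine (MvPolynomial.totalDegree_pow _ _).trans_lt ?_
    exact Nat.mul_lt_mul_of_pos_left (by omega) (by omega))
  have hval : ∀ l : σ → K, MvPolynomial.eval l (r ^ (Fintype.card K - 1))
      = 1 - if l = 0 then 1 else 0 := by
    intro l
    rw [map_pow]
    split_ifs with h
    · have : MvPolynomial.eval l r = 0 := by
        have := heval l
        rw [h] at this
        simpa [h] using this
      rw [this, zero_pow (by omega), sub_self]
    · have : MvPolynomial.eval l r ≠ 0 := by
        intro h0
        have := heval l
        rw [h0, mul_zero] at this
        exact hdet l h this.symm
      rw [FiniteField.pow_card_sub_one_eq_one _ this, sub_zero]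
  have hσ : Fintype.card σ ≠ 0 := by omega
  simp only [hval] at hsum
  rw [Finset.sum_sub_distrib, Finset.sum_const, Finset.sum_ite_eq' Finset.univ (0 : σ → K),
    Finset.card_univ, Fintype.card_fun] at hsum
  simp [hσ] at hsum

/-! ### Dimension counts for β and τ -/

section LinearAlgebra

variable {K V W : Type*} [Field K] [AddCommGroup V] [Module K V] [FiniteDimensional K V]
  [AddCommGroup W] [Module K W] [FiniteDimensional K W]

theorem two_mul_finrank_le [Fintype K] [Nontrivial V] (β : V →ₗ[K] V →ₗ[K] W)
    (halt : ∀ x, β x x = 0) (hsurj : ∀ a, a ≠ 0 → Function.Surjective (β a)) :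
    2 * finrank K W ≤ finrank K V := by
  classical
  let b := finBasis K V
  let c := finBasis K W
  have hskew : ∀ x y, β x y = -β y x := fun x y => (LinearMap.IsAlt.neg halt y x).symm
  have : Nonempty (Fin (finrank K V)) := ⟨⟨0, finrank_pos⟩⟩
  have key := two_mul_card_le_of_det_ne_zero (K := K) (ι := Fin (finrank K V))
    (σ := Fin (finrank K W)) (fun s => Matrix.of fun i j => c.coord s (β (b i) (b j)))
    (fun s => by
      ext i j
      simp only [Matrix.transpose_apply, Matrix.of_apply, Matrix.neg_apply]
      rw [hskew, map_neg])
    (fun s i => by simp [halt])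
    (fun l hl hdet => by
      -- A null vector v gives a ≠ 0 with l ∘ β(a, ·) = 0; surjectivity of β(a, ·) then kills l.
      obtain ⟨v, hv, hv0⟩ := Matrix.exists_vecMul_eq_zero_iff.mpr hdet
      have ha : ∑ i, v i • b i ≠ 0 := fun h =>
        hv (funext (Fintype.linearIndependent_iff.mp b.linearIndependent v h))
      have hφ : (∑ s, l s • c.coord s).comp (β (∑ i, v i • b i)) = 0 := by
        refine b.ext fun j => ?_
        have := congrFun hv0 j
        simp only [Matrix.vecMul, dotProduct, Matrix.sum_apply, Matrix.smul_apply,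
          Matrix.of_apply, Pi.zero_apply, smul_eq_mul] at this
        simp only [LinearMap.comp_apply, map_sum, map_smul, LinearMap.sum_apply,
          LinearMap.smul_apply, LinearMap.zero_apply, smul_eq_mul]
        rw [← this]
      refine hl (funext fun s => ?_)
      obtain ⟨x, hx⟩ := hsurj _ ha (c s)
      have := LinearMap.congr_fun hφ x
      rw [LinearMap.comp_apply, hx] at this
      simpa [Finsupp.single_apply] using this)
  simpa using key

/-- The map β embeds C into its own annihilator. -/
theorem finrank_le_of_isotropic (β : V →ₗ[K] V →ₗ[K] K) (hβ : Function.Injective β)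
    (C : Submodule K V) (hC : ∀ c ∈ C, ∀ d ∈ C, β c d = 0) : 2 * finrank K C ≤ finrank K V := by
  have h1 : finrank K C ≤ finrank K C.dualAnnihilator := by
    let f : C →ₗ[K] C.dualAnnihilator := LinearMap.codRestrict C.dualAnnihilator
      (β.comp C.subtype) (fun c => (Submodule.mem_dualAnnihilator _).mpr fun d hd => hC c c.2 d hd)
    refine LinearMap.finrank_le_finrank_of_injective (f := f) fun x y hxy => ?_
    exact Subtype.ext (hβ (congrArg Subtype.val hxy))
  have h2 := Subspace.finrank_add_finrank_dualAnnihilator_eq C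
  omega

variable [Fintype K] (β : V →ₗ[K] V →ₗ[K] W) (τ : W →ₗ[K] V →ₗ[K] K)

theorem finrank_eq_of_isotropic (halt : ∀ x, β x x = 0)
    (hsurj : ∀ a, a ≠ 0 → Function.Surjective (β a)) (hτ : τ ≠ 0)
    (hC : ∀ c ∈ LinearMap.ker τ.flip, ∀ d ∈ LinearMap.ker τ.flip, τ (β c d) = 0) :
    finrank K V = 2 * finrank K W ∧ finrank K (LinearMap.ker τ.flip) = finrank K W ∧
      LinearMap.ker τ = ⊥ := by
  have hV : Nontrivial V := by
    by_contra hV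
    rw [not_nontrivial_iff_subsingleton] at hV
    exact hτ (LinearMap.ext fun w => LinearMap.ext fun v => by
      rw [Subsingleton.elim v 0, map_zero, map_zero])
  have h1 := two_mul_finrank_le β halt hsurj
  -- The hypothesis only places β(C, C) inside ker τ, not yet known to be zero; a functional
  -- vanishing on ker τ makes C isotropic for l ∘ β.
  obtain ⟨l, hl, hl'⟩ : ∃ l : W →ₗ[K] K, l ≠ 0 ∧ ∀ w ∈ LinearMap.ker τ, l w = 0 := by
    obtain ⟨w, hw⟩ : ∃ w, w ∉ LinearMap.ker τ := by
      by_contra! h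
      exact hτ (LinearMap.ext fun w => h w)
    obtain ⟨l, hl, hl'⟩ := Submodule.exists_dual_map_eq_bot_of_notMem hw inferInstance
    refine ⟨l, fun h => hl (by rw [h]; rfl), fun w hw => ?_⟩
    have : l w ∈ (LinearMap.ker τ).map l := Submodule.mem_map_of_mem hw
    rwa [hl', Submodule.mem_bot] at this
  have h2 : 2 * finrank K (LinearMap.ker τ.flip) ≤ finrank K V := by
    refine finrank_le_of_isotropic (β.compr₂ l) ?_ _ fun c hc d hd => hl' _ (hC c hc d hd)
    rw [injective_iff_map_eq_zero]
    intro a ha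
    by_contra h0
    refine hl (LinearMap.ext fun w => ?_)
    obtain ⟨x, rfl⟩ := hsurj a h0 w
    exact LinearMap.congr_fun ha x
  have h3 : finrank K (LinearMap.range τ.flip) + finrank K (LinearMap.ker τ.flip)
    = finrank K V := LinearMap.finrank_range_add_finrank_ker _
  have h4 : finrank K (LinearMap.range τ.flip) ≤ finrank K (LinearMap.ker τ).dualAnnihilator := by
    refine Submodule.finrank_mono ?_
    rintro _ ⟨v, rfl⟩
    rw [Submodule.mem_dualAnnihilator]
    intro w hw
    exact LinearMap.congr_fun hw v
  have h5 := Subspace.finrank_add_finrank_dualAnnihilator_eq (LinearMap.ker τ)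
  refine ⟨by omega, by omega, Submodule.finrank_eq_zero.mp (by omega)⟩

theorem nondegenerate_of_ker_ne (halt : ∀ x, β x x = 0)
    (hsurj : ∀ a, a ≠ 0 → Function.Surjective (β a)) (hτ : τ ≠ 0)
    (hC : ∀ c ∈ LinearMap.ker τ.flip, ∀ d ∈ LinearMap.ker τ.flip, τ (β c d) = 0)
    {a : V} (ha : a ≠ 0)
    (hU : ∀ x ∈ LinearMap.ker (β a), ∀ y ∈ LinearMap.ker (β a), β x y = 0)
    (hne : LinearMap.ker (β a) ≠ LinearMap.ker τ.flip) :
    Disjoint (LinearMap.ker (β a)) (LinearMap.ker τ.flip) ∧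
      ∀ w, (∀ u ∈ LinearMap.ker (β a), τ w u = 0) → w = 0 := by
  obtain ⟨h1, h2, h3⟩ := finrank_eq_of_isotropic β τ halt hsurj hτ hC
  have hker : ∀ u, u ≠ 0 → finrank K (LinearMap.ker (β u)) = finrank K W := by
    intro u hu
    have := LinearMap.finrank_range_add_finrank_ker (β u)
    rw [LinearMap.range_eq_top.mpr (hsurj u hu), finrank_top] at this
    omega
  have hdis : Disjoint (LinearMap.ker (β a)) (LinearMap.ker τ.flip) := by
    rw [Submodule.disjoint_def]
    intro u hu hu'
    by_contra h0
    refine hne ?_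
    -- A common nonzero u makes both subspaces equal to ker (β u): the first since β vanishes on ker
    -- (β a), the second since τ has no left kernel.
    have e1 : LinearMap.ker (β a) = LinearMap.ker (β u) :=
      Submodule.eq_of_le_of_finrank_eq (fun y hy => hU u hu y hy) (by rw [hker a ha, hker u h0])
    have e2 : LinearMap.ker τ.flip = LinearMap.ker (β u) := by
      refine Submodule.eq_of_le_of_finrank_eq (fun y hy => ?_) (by rw [h2, hker u h0])
      have : β u y ∈ LinearMap.ker τ := hC u hu' y hy
      rwa [h3, Submodule.mem_bot] at this
    rw [e1, e2]
  refine ⟨hdis, fun w hw => ?_⟩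
  have htop : LinearMap.ker (β a) ⊔ LinearMap.ker τ.flip = ⊤ := by
    refine Submodule.eq_top_of_disjoint _ _ ?_ hdis
    rw [hker a ha, h2, h1, two_mul]
  have : w ∈ LinearMap.ker τ := by
    refine LinearMap.ext fun v => ?_
    obtain ⟨u, hu, c, hc, rfl⟩ := Submodule.mem_sup.mp (htop ▸ Submodule.mem_top : v ∈ _)
    have hc' : τ w c = 0 := LinearMap.congr_fun hc w
    rw [map_add, hw u hu, hc', add_zero]
    rfl
  rwa [h3, Submodule.mem_bot] at this

end LinearAlgebra

/-- A biadditive map of `ZMod p`-modules is bilinear. -/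
def bilinOfBiadditive (p : ℕ) {U V W : Type*} [AddCommGroup U] [AddCommGroup V] [AddCommGroup W]
    [Module (ZMod p) U] [Module (ZMod p) V] [Module (ZMod p) W] (f : U →+ V →+ W) :
    U →ₗ[ZMod p] V →ₗ[ZMod p] W :=
  AddMonoidHom.toZModLinearMap p
    ((AddMonoidHom.toZModLinearMapEquiv p (M := V) (M₁ := W)).toAddMonoidHom.comp f)

/-- Bimultiplicative form of `nondegenerate_of_ker_ne`. -/
theorem nondegenerate_of_bimultiplicative {p : ℕ} [Fact p.Prime] {P Q : Type*} [CommGroup P]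
    [CommGroup Q] [Finite P] [Finite Q] [Module (ZMod p) (Additive P)] [Module (ZMod p) (Additive Q)]
    (B : P →* P →* Q) (T : Q →* P →* Multiplicative (ZMod p)) (halt : ∀ x, B x x = 1)
    (hsurj : ∀ a, a ≠ 1 → Function.Surjective (B a)) (hT : T ≠ 1)
    (hC : ∀ c d, (∀ w, T w c = 1) → (∀ w, T w d = 1) → ∀ z, T (B c d) z = 1)
    {a : P} (ha : a ≠ 1) (hU : ∀ x y, B a x = 1 → B a y = 1 → B x y = 1)
    (hne : ¬ ∀ x, B a x = 1 ↔ ∀ w, T w x = 1) :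
    (∀ u, B a u = 1 → (∀ w, T w u = 1) → u = 1) ∧
      ∀ w, (∀ u, B a u = 1 → T w u = 1) → w = 1 := by
  have : Module.Finite (ZMod p) (Additive P) := Module.Finite.of_finite
  have : Module.Finite (ZMod p) (Additive Q) := Module.Finite.of_finite
  let β : Additive P →ₗ[ZMod p] Additive P →ₗ[ZMod p] Additive Q :=
    bilinOfBiadditive p (AddMonoidHom.mk' (fun v => MonoidHom.toAdditive (B v.toMul)) fun v w =>
      AddMonoidHom.ext fun x =>
        congrArg (fun f => Additive.ofMul (f x.toMul)) (map_mul B v.toMul w.toMul))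
  let τ : Additive Q →ₗ[ZMod p] Additive P →ₗ[ZMod p] ZMod p :=
    bilinOfBiadditive p (AddMonoidHom.mk' (fun v => MonoidHom.toAdditiveLeft (T v.toMul)) fun v w =>
      AddMonoidHom.ext fun x =>
        congrArg (fun f => Multiplicative.toAdd (f x.toMul)) (map_mul T v.toMul w.toMul))
  have hflip : ∀ c : Additive P, c ∈ LinearMap.ker τ.flip ↔ ∀ w, T w c.toMul = 1 := fun c =>
    ⟨fun h w => LinearMap.congr_fun (LinearMap.mem_ker.mp h) (Additive.ofMul w),
      fun h => LinearMap.mem_ker.mpr (LinearMap.ext fun w => h w.toMul)⟩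
  obtain ⟨h1, h2⟩ := nondegenerate_of_ker_ne β τ (fun x => halt x.toMul)
    (fun a ha w => hsurj a.toMul ha w)
    (fun h => hT (MonoidHom.ext fun w => MonoidHom.ext fun v =>
      LinearMap.congr_fun (LinearMap.congr_fun h (Additive.ofMul w)) (Additive.ofMul v)))
    (fun c hc d hd => LinearMap.ext fun z =>
      hC c.toMul d.toMul ((hflip c).mp hc) ((hflip d).mp hd) z.toMul)
    (a := Additive.ofMul a) ha (fun x hx y hy => hU x.toMul y.toMul hx hy)
    (fun h => hne fun x => (SetLike.ext_iff.mp h (Additive.ofMul x)).trans (hflip _))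
  exact ⟨fun u hu hu' => Submodule.disjoint_def.mp h1 (Additive.ofMul u) hu ((hflip _).mpr hu'),
    fun w hw => h2 (Additive.ofMul w) fun u hu => hw u.toMul hu⟩

/-- Three subgroups lemma: [C, H] lies in K, which C centralizes. In the application H = G/N and K
is the image of G', so C is C(N)/N. -/
theorem commutator_commutator_eq_one_of_mem_centralizer {H : Type*} [Group H] {K : Subgroup H}
    (hK : commutator H ≤ K) {c d : H} (hc : c ∈ Subgroup.centralizer (K : Set H))
    (hd : d ∈ Subgroup.centralizer (K : Set H)) (z : H) : ⁅⁅c, d⁆, z⁆ = 1 := by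
  set C := Subgroup.centralizer (K : Set H)
  have h : ⁅commutator H, C⁆ = ⊥ := by
    rw [Subgroup.commutator_eq_bot_iff_le_centralizer, Subgroup.le_centralizer_iff]
    exact Subgroup.centralizer_le hK
  have h1 : ⁅⁅C, (⊤ : Subgroup H)⁆, C⁆ = ⊥ :=
    le_bot_iff.mp (h ▸ Subgroup.commutator_mono (Subgroup.commutator_mono le_top le_rfl) le_rfl)
  have h2 : ⁅⁅(⊤ : Subgroup H), C⁆, C⁆ = ⊥ := by rwa [Subgroup.commutator_comm ⊤ C]
  have h3 := Subgroup.commutator_commutator_eq_bot_of_rotate h1 h2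
  rw [← Subgroup.mem_bot, ← h3]
  exact Subgroup.commutator_mem_commutator (Subgroup.commutator_mem_commutator hc hd)
    (Subgroup.mem_top z)

/-! ### A criterion for extraspecial groups -/

section Extraspecial

variable {p : ℕ} [Fact p.Prime] {E : Type*} [Group E] [Finite E]

theorem frattini_le_center_of_commutator_eq_center (hcard : Nat.card (Subgroup.center E) = p)
    (hE : commutator E = Subgroup.center E) : frattini E ≤ Subgroup.center E := by
  intro x hx
  rw [Subgroup.mem_center_iff]
  intro y
  have hmem : ∀ g h : E, ⁅g, h⁆ ∈ Subgroup.center E := fun g h => hE ▸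
    Subgroup.commutator_mem_commutator (Subgroup.mem_top g) (Subgroup.mem_top h)
  let f : E →* Subgroup.center E := MonoidHom.mk' (fun g => ⟨⁅g, y⁆, hmem g y⟩) fun g h => by
    refine Subtype.ext ?_
    change ⁅g * h, y⁆ = ⁅g, y⁆ * ⁅h, y⁆
    have := Subgroup.mem_center_iff.mp (hmem h y) g
    rw [show ⁅g * h, y⁆ = (g * ⁅h, y⁆) * (y * g⁻¹ * y⁻¹) by simp only [commutatorElement_def]; group,
      this, mul_assoc, ← Subgroup.mem_center_iff.mp (hmem h y)]
    simp only [commutatorElement_def]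
    group
  have hf : ∀ g, f g = 1 ↔ y * g = g * y := fun g => by
    rw [Subtype.ext_iff]
    exact commutatorElement_eq_one_iff_mul_comm.trans eq_comm
  by_contra hxy
  have hcp : (Nat.card (Subgroup.center E)).Prime := hcard ▸ Fact.out
  -- If x and y do not commute, g ↦ [g, y] maps onto the centre of order p, so its kernel is maximal
  -- and contains the Frattini subgroup, including x.
  have hsurj : Function.Surjective f := by
    rw [← MonoidHom.range_eq_top]
    have := Fact.mk hcp
    refine (Subgroup.eq_bot_or_eq_top_of_prime_card f.range).resolve_left fun h => ?_
    have : f x ∈ f.range := ⟨x, rfl⟩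
    rw [h, Subgroup.mem_bot, hf] at this
    exact hxy this
  have hco : IsCoatom (⊥ : Subgroup (Subgroup.center E)) := by
    have := Fact.mk hcp
    have : Nontrivial (Subgroup.center E) := Finite.one_lt_card_iff_nontrivial.mp hcp.one_lt
    exact ⟨bot_ne_top, fun b hb => (Subgroup.eq_bot_or_eq_top_of_prime_card b).resolve_left hb.ne'⟩
  have hx' := frattini_le_coatom (Subgroup.isCoatom_comap_of_surjective hsurj hco) hx
  exact hxy ((hf x).mp hx')

/-- A maximal M not containing Z satisfies E = MZ, whence Z = E' = M' ≤ M. -/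
theorem center_le_frattini_of_commutator_eq_center {E : Type*} [Group E]
    (hE : commutator E = Subgroup.center E) : Subgroup.center E ≤ frattini E := by
  refine le_iInf₂ fun M hM => ?_
  by_contra hle
  have htop : M ⊔ Subgroup.center E = ⊤ := hM.2 _ (left_lt_sup.mpr hle)
  refine hle (hE ▸ ?_)
  rw [commutator_def, Subgroup.commutator_le]
  have hmul : ∀ g : E, ∃ m ∈ M, ∃ z ∈ Subgroup.center E, m * z = g := fun g =>
    Subgroup.mem_sup_of_normal_right.mp (htop ▸ Subgroup.mem_top g)
  intro g _ h _
  obtain ⟨m, hm, z, hz, rfl⟩ := hmul g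
  obtain ⟨n, hn, w, hw, rfl⟩ := hmul h
  have key : ∀ m z g : E, z ∈ Subgroup.center E → ⁅m * z, g⁆ = ⁅m, g⁆ := fun m z g hz => by
    have h : z * g * z⁻¹ = g := by rw [← Subgroup.mem_center_iff.mp hz, mul_inv_cancel_right]
    rw [show ⁅m * z, g⁆ = m * (z * g * z⁻¹) * m⁻¹ * g⁻¹ by simp only [commutatorElement_def]; group,
      h, commutatorElement_def]
  rw [key m z _ hz, ← commutatorElement_inv, key n w m hw, commutatorElement_inv]
  exact M.mul_mem (M.mul_mem (M.mul_mem hm hn) (M.inv_mem hm)) (M.inv_mem hn)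

theorem isExtraspecial_of_commutator_eq_center (hpE : IsPGroup p E)
    (hcard : Nat.card (Subgroup.center E) = p) (hE : commutator E = Subgroup.center E) :
    IsExtraspecial p E where
  isPGroup := hpE
  card_center := hcard
  commutator_eq := hE
  frattini_eq := le_antisymm (frattini_le_center_of_commutator_eq_center hcard hE)
    (center_le_frattini_of_commutator_eq_center hE)

end Extraspecial

/-! ### Commutator pairings on the lower central factors -/

section CommutatorMaps

variable {G : Type*} [Group G]

theorem commutatorElement_mem_commutator (x y : G) : ⁅x, y⁆ ∈ commutator G :=
  Subgroup.commutator_mem_commutator (Subgroup.mem_top x) (Subgroup.mem_top y)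

theorem commutatorElement_mem_third {w : G} (hw : w ∈ commutator G) (x : G) : ⁅w, x⁆ ∈ third G :=
  Subgroup.commutator_mem_commutator hw (Subgroup.mem_top x)

theorem commutatorElement_mem_third' {w : G} (hw : w ∈ commutator G) (x : G) : ⁅x, w⁆ ∈ third G :=
  commutatorElement_inv w x ▸ (third G).inv_mem (commutatorElement_mem_third hw x)

theorem third_le_commutator : third G ≤ commutator G :=
  Subgroup.commutator_le_left _ _

variable (G) in
/-- The section `G'/G₃`. -/
abbrev CommutatorQuotient : Type _ :=
  commutator G ⧸ (third G).subgroupOf (commutator G)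

theorem commutatorQuotient_mk_eq {v w : commutator G} :
    (QuotientGroup.mk v : CommutatorQuotient G) = QuotientGroup.mk w ↔
      (v : G)⁻¹ * w ∈ third G := by
  rw [QuotientGroup.eq, Subgroup.mem_subgroupOf]
  rfl

theorem commutatorQuotient_mk_eq_one {v : commutator G} :
    (QuotientGroup.mk v : CommutatorQuotient G) = 1 ↔ (v : G) ∈ third G := by
  rw [QuotientGroup.eq_one_iff, Subgroup.mem_subgroupOf]

instance : CommGroup (CommutatorQuotient G) where
  mul_comm x y := by
    induction x using QuotientGroup.induction_on with | H v => ?_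
    induction y using QuotientGroup.induction_on with | H w => ?_
    rw [← QuotientGroup.mk_mul, ← QuotientGroup.mk_mul, commutatorQuotient_mk_eq]
    have h := commutatorElement_mem_third ((commutator G).inv_mem w.2) (v : G)⁻¹
    rw [commutatorElement_def] at h
    simpa [mul_assoc] using h

/-- The class of a commutator in `G'/G₃`. -/
def commutatorClass (x y : G) : CommutatorQuotient G :=
  QuotientGroup.mk ⟨⁅x, y⁆, commutatorElement_mem_commutator x y⟩

theorem commutatorClass_eq_one {x y : G} : commutatorClass x y = 1 ↔ ⁅x, y⁆ ∈ third G :=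
  commutatorQuotient_mk_eq_one

theorem commutatorClass_mul_left (x y z : G) :
    commutatorClass (x * y) z = commutatorClass x z * commutatorClass y z := by
  rw [mul_comm (commutatorClass x z)]
  refine (commutatorQuotient_mk_eq.mpr ?_).symm
  have h := commutatorElement_mem_third ((commutator G).inv_mem
    (commutatorElement_mem_commutator y z)) x
  change (⁅y, z⁆ * ⁅x, z⁆)⁻¹ * ⁅x * y, z⁆ ∈ third G
  convert Subgroup.Normal.conj_mem inferInstance _ h ⁅x, z⁆⁻¹ using 1
  simp only [commutatorElement_def]
  group

theorem commutatorClass_inv (x y : G) : (commutatorClass x y)⁻¹ = commutatorClass y x := by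
  refine commutatorQuotient_mk_eq.mpr ?_
  change ⁅x, y⁆⁻¹⁻¹ * ⁅y, x⁆ ∈ third G
  rw [inv_inv, ← commutatorElement_inv y x, inv_mul_cancel]
  exact one_mem _

theorem commutatorClass_mul_right (x y z : G) :
    commutatorClass x (y * z) = commutatorClass x y * commutatorClass x z := by
  rw [← commutatorClass_inv, commutatorClass_mul_left, mul_inv, commutatorClass_inv,
    commutatorClass_inv]

variable (G) in
/-- The map `G/G' × G/G' → G'/G₃` induced by taking commutators. -/
def commutatorPairing : Abelianization G →* Abelianization G →* CommutatorQuotient G :=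
  Abelianization.lift <| MonoidHom.mk' (fun x => Abelianization.lift <|
    MonoidHom.mk' (commutatorClass x) (commutatorClass_mul_right x)) fun x y => by
      ext z
      exact commutatorClass_mul_left x y z

theorem commutatorPairing_of (x y : G) :
    commutatorPairing G (Abelianization.of x) (Abelianization.of y) = commutatorClass x y :=
  rfl

variable {M : Type*} [CommGroup M] (hz : third G ≤ Subgroup.center G) (ε : third G →* M)

/-- The map `G'/G₃ × G/G' → M` induced by commutators and a homomorphism `G₃ → M`, when `G₃` is
central. -/
def thirdPairing : CommutatorQuotient G →* Abelianization G →* M :=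
  QuotientGroup.lift _ (MonoidHom.mk' (fun w : commutator G => Abelianization.lift <|
    MonoidHom.mk' (fun x => ε ⟨⁅(w : G), x⁆, commutatorElement_mem_third w.2 x⟩) fun x y => by
      rw [← map_mul]
      refine congrArg ε (Subtype.ext ?_)
      have h := Subgroup.mem_center_iff.mp (hz (commutatorElement_mem_third w.2 y)) x
      change ⁅(w : G), x * y⁆ = ⁅(w : G), x⁆ * ⁅(w : G), y⁆
      rw [show ⁅(w : G), x * y⁆ = ⁅(w : G), x⁆ * (x * ⁅(w : G), y⁆ * x⁻¹) by
        simp only [commutatorElement_def]; group, h, mul_inv_cancel_right]) fun v w => by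
      ext x
      change ε _ = ε _ * ε _
      rw [← map_mul]
      refine congrArg ε (Subtype.ext ?_)
      have h := Subgroup.mem_center_iff.mp (hz (commutatorElement_mem_third w.2 x)) v
      have h' := Subgroup.mem_center_iff.mp (hz (commutatorElement_mem_third w.2 x)) ⁅(v : G), x⁆
      change ⁅(v : G) * w, x⁆ = ⁅(v : G), x⁆ * ⁅(w : G), x⁆
      rw [h', show ⁅(v : G) * w, x⁆ = (v * ⁅(w : G), x⁆ * (v : G)⁻¹) * ⁅(v : G), x⁆ by
        simp only [commutatorElement_def]; group, h, mul_inv_cancel_right]) (by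
    intro w hw
    rw [MonoidHom.mem_ker]
    ext x
    change ε _ = 1
    convert map_one ε
    have := Subgroup.mem_center_iff.mp (hz (Subgroup.mem_subgroupOf.mp hw)) x
    exact commutatorElement_eq_one_iff_mul_comm.mpr this.symm)

theorem abelianization_pow_eq_one {p : ℕ} (h : ∀ x : G, x ^ p ∈ commutator G) (x : Abelianization G) :
    x ^ p = 1 := by
  induction x using QuotientGroup.induction_on with | H x => ?_
  exact (QuotientGroup.eq_one_iff _).mpr (h x)

theorem mem_centC_iff {N : Subgroup G} [N.Normal] {x : G} :
    x ∈ centC N ↔ ∀ w ∈ commutator G, ⁅w, x⁆ ∈ N := by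
  simp only [centC, Subgroup.mem_comap, Subgroup.mem_centralizer_iff, Subgroup.coe_map,
    Set.forall_mem_image, SetLike.mem_coe]
  refine forall₂_congr fun w _ => ?_
  rw [← commutatorElement_eq_one_iff_mul_comm, ← map_commutatorElement]
  exact QuotientGroup.eq_one_iff _

theorem commutator_le_centA (a : G) : commutator G ≤ centA a := fun w hw =>
  (mem_centA_iff a w).mpr (commutatorElement_mem_third' hw a)

end CommutatorMaps

/-! ### Camina groups and nondegeneracy on A(a) -/

section Camina

variable {p : ℕ} [Fact p.Prime] {G : Type*} [Group G]

theorem IsCamina.exists_commutatorElement_eq (hcam : IsCamina G) {a : G} (ha : a ∉ commutator G)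
    {w : G} (hw : w ∈ commutator G) : ∃ y, ⁅a, y⁆ = w := by
  -- This element is w⁻¹a; if it equals cac⁻¹ then [a, c] = w.
  have h : a * (a⁻¹ * w⁻¹ * a) ∈ conjugatesOf a := by
    rw [hcam a ha]
    refine Set.smul_mem_smul_set ?_
    have := (inferInstance : (commutator G).Normal).conj_mem _ ((commutator G).inv_mem hw) a⁻¹
    rwa [inv_inv] at this
  obtain ⟨c, hc⟩ := isConj_iff.mp h
  refine ⟨c, ?_⟩
  rw [← commutatorElement_inv, inv_eq_iff_eq_inv, commutatorElement_def, hc]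
  group

theorem IsCamina.commutatorQuotient_pow_eq_one {p : ℕ} (hcam : IsCamina G)
    (h : ∀ x : G, x ^ p ∈ commutator G) {a : G} (ha : a ∉ commutator G)
    (q : CommutatorQuotient G) : q ^ p = 1 := by
  induction q using QuotientGroup.induction_on with | H w => ?_
  obtain ⟨y, hy⟩ := hcam.exists_commutatorElement_eq ha w.2
  have : (QuotientGroup.mk w : CommutatorQuotient G) =
      commutatorPairing G (Abelianization.of a) (Abelianization.of y) :=
    congrArg QuotientGroup.mk (Subtype.ext hy.symm)
  rw [this, ← map_pow, abelianization_pow_eq_one h, map_one]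

variable [Finite G]

/-- If x^p were outside G', the classes [x^p, y] = [x, y]^p would fill G'/G₃, making the p-power map
bijective on a nontrivial finite p-group. -/
theorem IsCamina.pow_mem_commutator (hp : IsPGroup p G) (hcam : IsCamina G)
    (hne : third G ≠ commutator G) (x : G) : x ^ p ∈ commutator G := by
  by_contra hx
  have hsurj : Function.Surjective fun q : CommutatorQuotient G => q ^ p := by
    intro q
    induction q using QuotientGroup.induction_on with | H w => ?_
    obtain ⟨y, hy⟩ := hcam.exists_commutatorElement_eq hx w.2
    refine ⟨commutatorClass x y, ?_⟩
    change commutatorClass x y ^ p = _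
    rw [← commutatorPairing_of, ← MonoidHom.pow_apply, ← map_pow, ← map_pow, commutatorPairing_of]
    exact congrArg QuotientGroup.mk (Subtype.ext hy)
  have hinj := Finite.injective_iff_surjective.mpr hsurj
  have hpQ : IsPGroup p (CommutatorQuotient G) := (hp.to_subgroup _).to_quotient _
  have hnt : Nontrivial (CommutatorQuotient G) := by
    by_contra h
    rw [not_nontrivial_iff_subsingleton] at h
    exact hne (le_antisymm third_le_commutator fun w hw =>
      commutatorQuotient_mk_eq_one.mp (Subsingleton.elim (QuotientGroup.mk ⟨w, hw⟩) 1))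
  obtain ⟨n, hn, hcard⟩ := hpQ.nontrivial_iff_card.mp hnt
  obtain ⟨q, hq⟩ := exists_prime_orderOf_dvd_card' (G := CommutatorQuotient G) p
    (hcard ▸ dvd_pow_self p hn.ne')
  have : q = 1 := hinj (by simp [← hq, pow_orderOf_eq_one])
  rw [this, orderOf_one] at hq
  exact (Fact.out : p.Prime).one_lt.ne hq

/-- If `A(a)/G₃` is abelian and `A(a) ≠ C(N)`, the commutator form on `A(a)/G₃` with values in
`G₃/N` is nondegenerate. -/
theorem IsCamina.mem_third_of_commutator_mem (hp : IsPGroup p G) (hcam : IsCamina G)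
    (hz : third G ≤ Subgroup.center G) (hne : third G ≠ commutator G) {N : Subgroup G} [N.Normal]
    (hNp : N.relIndex (third G) = p) {a : G} (ha : a ∉ commutator G)
    (hA : ∀ x ∈ centA a, ∀ y ∈ centA a, ⁅x, y⁆ ∈ third G) (hAC : centA a ≠ centC N) {x : G}
    (hx : x ∈ centA a) (hxA : ∀ y ∈ centA a, ⁅x, y⁆ ∈ N) : x ∈ third G := by
  have hpow := hcam.pow_mem_commutator hp hne
  let : Module (ZMod p) (Additive (Abelianization G)) :=
    AddCommGroup.zmodModule fun x => abelianization_pow_eq_one hpow x.toMul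
  let : Module (ZMod p) (Additive (CommutatorQuotient G)) :=
    AddCommGroup.zmodModule fun x => hcam.commutatorQuotient_pow_eq_one hpow ha x.toMul
  -- Identifying G₃/N with 𝔽_p makes the pairing scalar-valued.
  obtain ⟨ε, hε⟩ : ∃ ε : third G →* Multiplicative (ZMod p), ∀ t, ε t = 1 ↔ (t : G) ∈ N := by
    let e : (third G ⧸ N.subgroupOf (third G)) ≃* Multiplicative (ZMod p) :=
      mulEquivOfPrimeCardEq (p := p) hNp (by simp)
    refine ⟨e.toMonoidHom.comp (QuotientGroup.mk' _), fun t => ?_⟩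
    change e (QuotientGroup.mk t) = 1 ↔ _
    rw [map_eq_one_iff e e.injective, QuotientGroup.eq_one_iff, Subgroup.mem_subgroupOf]
  let B := commutatorPairing G
  let T := thirdPairing hz ε
  have hT1 : ∀ (w : commutator G) (x : G),
      T (QuotientGroup.mk w) (Abelianization.of x) = 1 ↔ ⁅(w : G), x⁆ ∈ N := fun w x => hε _
  have hBA : ∀ x, B (Abelianization.of a) (Abelianization.of x) = 1 ↔ x ∈ centA a := fun x =>
    commutatorClass_eq_one.trans (mem_centA_iff a x).symm
  have hTC : ∀ x, (∀ w, T w (Abelianization.of x) = 1) ↔ x ∈ centC N := by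
    intro x
    rw [mem_centC_iff]
    constructor
    · intro h w hw
      exact (hT1 ⟨w, hw⟩ x).mp (h _)
    · intro h w
      induction w using QuotientGroup.induction_on with | H w => ?_
      exact (hT1 w x).mpr (h w w.2)
  have hof : ∀ P : Abelianization G, ∃ x, Abelianization.of x = P := QuotientGroup.mk_surjective
  obtain ⟨h1, h2⟩ := nondegenerate_of_bimultiplicative B T
    (by
      intro x
      obtain ⟨x, rfl⟩ := hof x
      refine commutatorClass_eq_one.mpr ?_
      rw [commutatorElement_self]
      exact one_mem _)
    (by
      intro x hx q
      obtain ⟨x, rfl⟩ := hof x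
      induction q using QuotientGroup.induction_on with | H w => ?_
      obtain ⟨y, hy⟩ := hcam.exists_commutatorElement_eq
        (fun h => hx ((QuotientGroup.eq_one_iff x).mpr h)) w.2
      exact ⟨Abelianization.of y, congrArg QuotientGroup.mk (Subtype.ext hy)⟩)
    (by
      intro hT
      have hle : third G ≤ N := Subgroup.commutator_le.mpr fun w hw x _ =>
        (hT1 ⟨w, hw⟩ x).mp (by rw [hT]; rfl)
      rw [Subgroup.relIndex_eq_one.mpr hle] at hNp
      exact (Fact.out : p.Prime).one_lt.ne hNp)
    (by
      intro c d hc hd z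
      obtain ⟨c, rfl⟩ := hof c
      obtain ⟨d, rfl⟩ := hof d
      obtain ⟨z, rfl⟩ := hof z
      refine (hT1 ⟨⁅c, d⁆, commutatorElement_mem_commutator c d⟩ z).mpr ?_
      have h := commutator_commutator_eq_one_of_mem_centralizer
        (K := (commutator G).map (QuotientGroup.mk' N)) (by
          rw [commutator_def, commutator_def, Subgroup.map_commutator, ← MonoidHom.range_eq_map,
            QuotientGroup.range_mk']) ((hTC c).mp hc) ((hTC d).mp hd) (QuotientGroup.mk' N z)
      rw [← map_commutatorElement, ← map_commutatorElement] at h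
      exact (QuotientGroup.eq_one_iff _).mp h)
    (a := Abelianization.of a) (fun h => ha ((QuotientGroup.eq_one_iff a).mp h))
    (by
      intro x y hx hy
      obtain ⟨x, rfl⟩ := hof x
      obtain ⟨y, rfl⟩ := hof y
      exact commutatorClass_eq_one.mpr (hA x ((hBA x).mp hx) y ((hBA y).mp hy)))
    (by
      intro h
      exact hAC (Subgroup.ext fun x => (hBA x).symm.trans ((h _).trans (hTC x))))
  -- Since G' ≤ A(a), the hypothesis on x includes [x, G'] ≤ N, so x lies in A(a) ∩ C(N).
  have hx' : x ∈ commutator G := by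
    refine (QuotientGroup.eq_one_iff x).mp (h1 (Abelianization.of x) ((hBA x).mpr hx) ?_)
    refine (hTC x).mpr (mem_centC_iff.mpr fun w hw => ?_)
    rw [← commutatorElement_inv]
    exact N.inv_mem (hxA w (commutator_le_centA a hw))
  refine commutatorQuotient_mk_eq_one.mp (h2 (QuotientGroup.mk ⟨x, hx'⟩) fun u hu => ?_)
  obtain ⟨u, rfl⟩ := hof u
  exact (hT1 _ u).mpr (hxA u ((hBA u).mp hu))

end Camina

/-! ### Consequences of nilpotency class three -/

section Main

variable {p : ℕ} [Fact p.Prime] {G : Type*} [Group G] [Finite G]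

theorem lowerCentralSeries_two_eq_third {G : Type*} [Group G] :
    (⊤ : Subgroup G).lowerCentralSeries 2 = third G := by
  rw [Subgroup.lowerCentralSeries_succ, Subgroup.top_lowerCentralSeries_one, third]

theorem third_le_center (hp : IsPGroup p G) (hclass : Group.nilpotencyClass G = 3) :
    third G ≤ Subgroup.center G := by
  have := hp.isNilpotent
  have h : (⊤ : Subgroup G).lowerCentralSeries 3 = ⊥ :=
    hclass ▸ Subgroup.lowerCentralSeries_nilpotencyClass
  rw [Subgroup.lowerCentralSeries_succ, lowerCentralSeries_two_eq_third,
    Subgroup.commutator_eq_bot_iff_le_centralizer, Subgroup.coe_top,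
    Subgroup.centralizer_univ] at h
  exact h

theorem third_ne_bot (hp : IsPGroup p G) (hclass : Group.nilpotencyClass G = 3) :
    third G ≠ ⊥ := by
  have := hp.isNilpotent
  intro h
  rw [← lowerCentralSeries_two_eq_third, Subgroup.lowerCentralSeries_eq_bot_iff_nilpotencyClass_le,
    hclass] at h
  omega

theorem third_ne_commutator (hp : IsPGroup p G) (hclass : Group.nilpotencyClass G = 3) :
    third G ≠ commutator G := by
  intro h
  refine third_ne_bot hp hclass ?_
  have h' := third_le_center hp hclass
  rw [h, ← Subgroup.centralizer_univ, ← Subgroup.coe_top,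
    ← Subgroup.commutator_eq_bot_iff_le_centralizer] at h'
  exact h'

theorem exists_le_relIndex_eq_prime (hp : IsPGroup p G) {H : Subgroup G} (hH : H ≠ ⊥) :
    ∃ N ≤ H, N.relIndex H = p := by
  have hpp : p.Prime := Fact.out
  obtain ⟨n, hn, hcard⟩ := (hp.to_subgroup H).nontrivial_iff_card.mp
    ((Subgroup.nontrivial_iff_ne_bot H).mpr hH)
  obtain ⟨m, rfl⟩ := Nat.exists_eq_succ_of_ne_zero hn.ne'
  obtain ⟨N, hNH, hN⟩ := Sylow.exists_subgroup_le_card_pow_prime_of_le_card (n := m) hpp hp (H := H)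
    (hcard ▸ Nat.pow_le_pow_right hpp.pos (Nat.le_succ m))
  refine ⟨N, hNH, ?_⟩
  have := Subgroup.relIndex_mul_relIndex ⊥ N H bot_le hNH
  rw [Subgroup.relIndex_bot_left, Subgroup.relIndex_bot_left, hN, hcard, pow_succ] at this
  exact Nat.eq_of_mul_eq_mul_left (pow_pos hpp.pos m) this

theorem normal_of_le_center {H : Type*} [Group H] {N : Subgroup H}
    (hN : N ≤ Subgroup.center H) : N.Normal :=
  ⟨fun n hn g => by rwa [Subgroup.mem_center_iff.mp (hN hn) g, mul_inv_cancel_right]⟩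

end Main

end CaminaGroup

/-! ### Centre and central quotients of A -/

open CaminaGroup in
theorem corollary5p3 {p : ℕ} [Fact p.Prime] {G : Type*} [Group G] [Finite G]
    (hp : IsPGroup p G) (hcam : CaminaGroup.IsCamina G) (hclass : Group.nilpotencyClass G = 3)
    (A : Subgroup G) (hA : A ∈ CaminaGroup.setAStar G \ CaminaGroup.setC p G) :
    CaminaGroup.IsSemiExtraspecial p A := by
  have hz := third_le_center hp hclass
  obtain ⟨⟨⟨a, ha, rfl⟩, hab⟩, hAC⟩ := hA
  have hcomm : ∀ x ∈ centA a, ∀ y ∈ centA a, ⁅x, y⁆ ∈ third G := by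
    intro x hx y hy
    refine (QuotientGroup.eq_one_iff _).mp ?_
    change QuotientGroup.mk' (third G) ⁅x, y⁆ = 1
    rw [map_commutatorElement, commutatorElement_eq_one_iff_mul_comm]
    exact congrArg Subtype.val (hab.is_comm.comm ⟨_, Subgroup.mem_map_of_mem _ hx⟩
      ⟨_, Subgroup.mem_map_of_mem _ hy⟩)
  have hnd : ∀ N ≤ third G, N.relIndex (third G) = p → ∀ x ∈ centA a,
      (∀ y ∈ centA a, ⁅x, y⁆ ∈ N) → x ∈ third G := by
    intro N hN hNp x hx hxA
    have hNn := normal_of_le_center (hN.trans hz)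
    exact hcam.mem_third_of_commutator_mem hp hz (third_ne_commutator hp hclass) hNp ha hcomm
      (fun h => hAC ⟨N, hNn, hN, hNp, h⟩) hx hxA
  have hle : third G ≤ centA a := third_le_commutator.trans (commutator_le_centA a)
  have haA : a ∈ centA a := (mem_centA_iff a a).mpr (by simp)
  have hcenter : Subgroup.center (centA a) = (third G).subgroupOf (centA a) := by
    ext x
    rw [Subgroup.mem_subgroupOf]
    constructor
    · intro hx
      -- One N suffices: a central x has [x, A] = 1 ≤ N.
      obtain ⟨N, hN, hNp⟩ := exists_le_relIndex_eq_prime hp (third_ne_bot hp hclass)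
      refine hnd N hN hNp x x.2 fun y hy => ?_
      have h := congrArg Subtype.val (Subgroup.mem_center_iff.mp hx ⟨y, hy⟩)
      rw [commutatorElement_eq_one_iff_mul_comm.mpr h.symm]
      exact one_mem N
    · intro hx
      exact Subgroup.mem_center_iff.mpr fun y =>
        Subtype.ext (Subgroup.mem_center_iff.mp (hz hx) y)
  have hmap : (Subgroup.center (centA a)).map (centA a).subtype = third G := by
    rw [hcenter, Subgroup.subgroupOf_map_subtype, inf_eq_left.mpr hle]
  refine ⟨hp.to_subgroup _, ⟨⟨a, haA⟩, 1, fun h => ha ?_⟩, fun N _ hN hNp => ?_⟩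
  · rw [show a = 1 from congrArg Subtype.val h]
    exact one_mem _
  let π := QuotientGroup.mk' N
  have hπ : ∀ x, π x = 1 ↔ x ∈ N := fun x => QuotientGroup.eq_one_iff x
  have hNmap : ∀ x : centA a, (x : G) ∈ N.map (centA a).subtype ↔ x ∈ N := fun x =>
    Subgroup.mem_map_iff_mem (centA a).subtype_injective
  have hquot : ∀ x : centA a, π x ∈ Subgroup.center (centA a ⧸ N) ↔
      x ∈ Subgroup.center (centA a) := by
    intro x
    constructor
    · intro hx
      rw [hcenter, Subgroup.mem_subgroupOf]
      refine hnd (N.map (centA a).subtype) (hmap ▸ Subgroup.map_mono hN) ?_ x x.2 fun y hy => ?_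
      · rw [← hmap, Subgroup.relIndex_map_map_of_injective _ _ (centA a).subtype_injective, hNp]
      · refine (hNmap ⁅x, ⟨y, hy⟩⁆).mpr ((hπ _).mp ?_)
        rw [map_commutatorElement, commutatorElement_eq_one_iff_mul_comm]
        exact (Subgroup.mem_center_iff.mp hx _).symm
    · intro hx
      rw [Subgroup.mem_center_iff]
      intro y
      obtain ⟨y, rfl⟩ := QuotientGroup.mk'_surjective N y
      change π y * π x = π x * π y
      rw [← map_mul, ← map_mul, Subgroup.mem_center_iff.mp hx y]
  have hcenterE : Subgroup.center (centA a ⧸ N) = (Subgroup.center (centA a)).map π := by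
    ext q
    obtain ⟨x, rfl⟩ := QuotientGroup.mk'_surjective N q
    rw [hquot]
    refine ⟨fun h => Subgroup.mem_map_of_mem π h, ?_⟩
    rintro ⟨y, hy, hxy⟩
    exact (hquot x).mp (hxy ▸ (hquot y).mpr hy)
  have hcard : Nat.card (Subgroup.center (centA a ⧸ N)) = p := by
    rw [hcenterE, ← hNp, ← Subgroup.relIndex_bot_left, ← Subgroup.relIndex_comap,
      MonoidHom.comap_bot, QuotientGroup.ker_mk']
  refine isExtraspecial_of_commutator_eq_center ((hp.to_subgroup _).to_quotient N) hcard ?_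
  have hEle : commutator (centA a ⧸ N) ≤ Subgroup.center (centA a ⧸ N) := by
    refine Subgroup.commutator_le.mpr fun x _ y _ => ?_
    obtain ⟨x, rfl⟩ := QuotientGroup.mk'_surjective N x
    obtain ⟨y, rfl⟩ := QuotientGroup.mk'_surjective N y
    rw [← map_commutatorElement, hquot, hcenter, Subgroup.mem_subgroupOf]
    exact hcomm x x.2 y y.2
  -- Were A/N abelian, a would be central modulo N, hence in G₃ ≤ G'. So the derived subgroup is a
  -- nontrivial subgroup of a centre of order p.
  have hEne : commutator (centA a ⧸ N) ≠ ⊥ := by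
    intro h
    have hmem : π ⟨a, haA⟩ ∈ Subgroup.center (centA a ⧸ N) := by
      rw [Subgroup.mem_center_iff]
      intro y
      rw [← commutatorElement_eq_one_iff_mul_comm, ← Subgroup.mem_bot, ← h]
      exact commutatorElement_mem_commutator _ _
    rw [hquot, hcenter, Subgroup.mem_subgroupOf] at hmem
    exact ha (third_le_commutator hmem)
  refine hEle.antisymm ?_
  rw [← Subgroup.subgroupOf_eq_top]
  have : Fact (Nat.card (Subgroup.center (centA a ⧸ N))).Prime := hcard ▸ inferInstance
  refine (Subgroup.eq_bot_or_eq_top_of_prime_card _).resolve_left fun h => hEne ?_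
  rw [Subgroup.subgroupOf_eq_bot] at h
  exact h.eq_bot_of_le hEle
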